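/- Let $\mathrm{Ter}^\infty(\lambda\tau)$ be the set of finite and infinite $\lambda\tau$-terms, that is, the terms generated coinductively by $$M ::= x \mid \lambda x.M \mid M\,M \mid \tau(M),$$ modulo renaming of bound variables (formally: possibly infinite term trees with de Bruijn indices). The \emph{clocked $\lambda$-calculus} has the two rules $$(\lambda x.M)\,N \to \tau(M[x:=N]), \qquad \tau(M)\,N \to \tau(M\,N),$$ which may be applied at any position of a term; the depth of a step is the length of the position of the contracted redex. Terms carry the usual metric: $d(M,N)\le 2^{-n}$ iff $M$ and $N$ coincide at all depths smaller than $n$. A \emph{rewrite sequence} of ordinal length $\alpha$ consists of steps $M_\beta \to M_{\beta+1}$ at depth $d_\beta$, for all $\beta<\alpha$, such that $M_\lambda=\lim_{\beta\to\lambda}M_\beta$ for each limit ordinal $\lambda<\alpha$. (If $\alpha$ is a limit ordinal, no term $M_\alpha$ is part of the sequence.) It is \emph{strongly convergent} if $d_\beta\to\infty$ as $\beta\to\lambda$ for each limit ordinal $\lambda\le\alpha$ and, in case $\alpha$ is a limit ordinal, $\lim_{\beta\to\alpha}M_\beta$ exists. Write $M\twoheadrightarrow^{\infty}N$ if there is a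 strongly convergent rewrite sequence of some ordinal length that starts with $M$ and has $N$ as its last term or, if its length is a limit ordinal, as its limit. A normal form is a term to which no rule applies at any position. Then the following three properties hold. 1. ($\mathrm{CR}^\infty$) For all $M,N_1,N_2\in\mathrm{Ter}^\infty(\lambda\tau)$: if $M\twoheadrightarrow^{\infty}N_1$ and $M\twoheadrightarrow^{\infty}N_2$, then there is a term $P$ with $N_1\twoheadrightarrow^{\infty}P$ and $N_2\twoheadrightarrow^{\infty}P$. 2. ($\mathrm{SN}^\infty$) Every infinite rewrite sequence is strongly convergent. 3. ($\mathrm{UN}^\infty$) For all $M,N_1,N_2\in\mathrm{Ter}^\infty(\lambda\tau)$: if $M\twoheadrightarrow^{\infty}N_1$, $M\twoheadrightarrow^{\infty}N_2$, and $N_1,N_2$ are normal forms, then $N_1=N_2$. -/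

import Mathlib

namespace ClockedLambda

/-- Node labels of lambda-tau-terms in de Bruijn notation. -/
inductive Label : Type
  | var (n : ℕ)
  | lam
  | app
  | tau

/-- The argument positions below a node with the given label. -/
abbrev Label.Arg : Label → Type
  | .var _ => Empty
  | .lam => Unit
  | .app => Bool
  | .tau => Unit

/-- The signature functor of lambda-tau-terms. -/
abbrev Sig : PFunctor.{0, 0} := ⟨Label, Label.Arg⟩

/-- Finite and infinite lambda-tau-terms, `M ::= x | λ M | M M | τ(M)` read coinductively (the final
coalgebra of the signature), modulo renaming of bound variables: variables are de Bruijn indices. -/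
abbrev Term : Type := Sig.M

namespace Term

/-- The variable with de Bruijn index `n`. -/
def var (n : ℕ) : Term := PFunctor.M.mk ⟨Label.var n, Empty.elim⟩

/-- Abstraction. -/
def lam (M : Term) : Term := PFunctor.M.mk ⟨Label.lam, fun _ => M⟩

/-- Application of `M` to `N`. -/
def app (M N : Term) : Term := PFunctor.M.mk ⟨Label.app, fun b => Bool.casesOn b M N⟩

/-- The unary clock symbol `τ(M)`. -/
def tau (M : Term) : Term := PFunctor.M.mk ⟨Label.tau, fun _ => M⟩

/-- Extension of a renaming under a binder. -/
def upRen (r : ℕ → ℕ) : ℕ → ℕ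
  | 0 => 0
  | n + 1 => r n + 1

/-- One layer of the renaming of free variables. -/
def renameStep : Term × (ℕ → ℕ) → Sig (Term × (ℕ → ℕ)) := fun p =>
  match PFunctor.M.dest p.1 with
  | ⟨.var n, _⟩ => ⟨Label.var (p.2 n), Empty.elim⟩
  | ⟨.lam, k⟩ => ⟨Label.lam, fun i => (k i, upRen p.2)⟩
  | ⟨.app, k⟩ => ⟨Label.app, fun i => (k i, p.2)⟩
  | ⟨.tau, k⟩ => ⟨Label.tau, fun i => (k i, p.2)⟩

/-- Renaming of free variables, by corecursion. -/
def rename (r : ℕ → ℕ) (M : Term) : Term := PFunctor.M.corec renameStep (M, r)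

/-- Extension of a substitution under a binder. -/
def upSub (σ : ℕ → Term) : ℕ → Term
  | 0 => var 0
  | n + 1 => rename Nat.succ (σ n)

/-- One layer of simultaneous substitution. A state `.inl (M, σ)` stands for `M` with `σ` still to be
performed, a state `.inr N` for a term `N` that is copied unchanged. -/
def substStep : (Term × (ℕ → Term)) ⊕ Term → Sig ((Term × (ℕ → Term)) ⊕ Term)
  | .inl p =>
    match PFunctor.M.dest p.1 with
    | ⟨.var n, _⟩ => Sig.map Sum.inr (PFunctor.M.dest (p.2 n))
    | ⟨.lam, k⟩ => ⟨Label.lam, fun i => .inl (k i, upSub p.2)⟩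
    | ⟨.app, k⟩ => ⟨Label.app, fun i => .inl (k i, p.2)⟩
    | ⟨.tau, k⟩ => ⟨Label.tau, fun i => .inl (k i, p.2)⟩
  | .inr N => Sig.map Sum.inr (PFunctor.M.dest N)

/-- Capture-avoiding simultaneous substitution, by corecursion. -/
def subst (σ : ℕ → Term) (M : Term) : Term := PFunctor.M.corec substStep (.inl (M, σ))

/-- `M[x := N]`, where `x` is the variable with index `0` in `M`; the other free variables of `M` are
shifted down. -/
def inst (M N : Term) : Term :=
  subst (fun n => Nat.casesOn n N var) M

/-! The defining equations of renaming and substitution. -/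

theorem eq_of_dest_eq {M N : Term} (h : PFunctor.M.dest M = PFunctor.M.dest N) : M = N := by
  rw [← PFunctor.M.mk_dest M, h, PFunctor.M.mk_dest]

theorem rename_var (r : ℕ → ℕ) (n : ℕ) : rename r (var n) = var (r n) := by
  apply eq_of_dest_eq
  simp only [rename, PFunctor.M.dest_corec, renameStep, var]
  exact congrArg (Sigma.mk (Label.var (r n))) (funext fun i => Empty.elim i)

theorem rename_lam (r : ℕ → ℕ) (M : Term) : rename r (lam M) = lam (rename (upRen r) M) := by
  apply eq_of_dest_eq
  simp only [rename, PFunctor.M.dest_corec, renameStep, lam]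
  rfl

theorem rename_app (r : ℕ → ℕ) (M N : Term) :
    rename r (app M N) = app (rename r M) (rename r N) := by
  apply eq_of_dest_eq
  simp only [rename, PFunctor.M.dest_corec, renameStep, app]
  exact congrArg (Sigma.mk Label.app) (funext fun i => by cases i <;> rfl)

theorem rename_tau (r : ℕ → ℕ) (M : Term) : rename r (tau M) = tau (rename r M) := by
  apply eq_of_dest_eq
  simp only [rename, PFunctor.M.dest_corec, renameStep, tau]
  rfl

theorem corec_substStep_inr (N : Term) : PFunctor.M.corec substStep (.inr N) = N := by
  refine PFunctor.M.bisim (fun a b => a = PFunctor.M.corec substStep (.inr b)) ?_ _ _ rfl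
  rintro _ y rfl
  refine ⟨(PFunctor.M.dest y).1, _, (PFunctor.M.dest y).2, ?_, rfl, fun i => rfl⟩
  rw [PFunctor.M.dest_corec]
  rfl

theorem subst_var (σ : ℕ → Term) (n : ℕ) : subst σ (var n) = σ n := by
  rw [← corec_substStep_inr (σ n)]
  apply eq_of_dest_eq
  simp only [subst, PFunctor.M.dest_corec, substStep, var]
  rfl

theorem subst_lam (σ : ℕ → Term) (M : Term) : subst σ (lam M) = lam (subst (upSub σ) M) := by
  apply eq_of_dest_eq
  simp only [subst, PFunctor.M.dest_corec, substStep, lam]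
  rfl

theorem subst_app (σ : ℕ → Term) (M N : Term) :
    subst σ (app M N) = app (subst σ M) (subst σ N) := by
  apply eq_of_dest_eq
  simp only [subst, PFunctor.M.dest_corec, substStep, app]
  exact congrArg (Sigma.mk Label.app) (funext fun i => by cases i <;> rfl)

theorem subst_tau (σ : ℕ → Term) (M : Term) : subst σ (tau M) = tau (subst σ M) := by
  apply eq_of_dest_eq
  simp only [subst, PFunctor.M.dest_corec, substStep, tau]
  rfl

end Term

open Term

/-- `StepAt d M N`: `M` rewrites to `N` by contracting one redex at a position of length `d`. -/
inductive StepAt : ℕ → Term → Term → Prop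
  | beta (M N : Term) : StepAt 0 (app (lam M) N) (tau (inst M N))
  | push (M N : Term) : StepAt 0 (app (tau M) N) (tau (app M N))
  | lam {d : ℕ} {M M' : Term} : StepAt d M M' → StepAt (d + 1) (lam M) (lam M')
  | appL {d : ℕ} {M M' : Term} (N : Term) : StepAt d M M' → StepAt (d + 1) (app M N) (app M' N)
  | appR {d : ℕ} (M : Term) {N N' : Term} : StepAt d N N' → StepAt (d + 1) (app M N) (app M N')
  | tau {d : ℕ} {M M' : Term} : StepAt d M M' → StepAt (d + 1) (tau M) (tau M')

/-- The single-step reduction relation of the clocked lambda-calculus. -/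
def Step (M N : Term) : Prop := ∃ d, StepAt d M N

/-- Normal forms: terms without redexes. -/
def NormalForm (M : Term) : Prop := ∀ N, ¬ Step M N

/-- `EqUpTo n M N`: the term trees `M` and `N` coincide at all depths smaller than `n`, that is, their
distance in the usual metric on infinite terms is at most `2⁻ⁿ`. -/
inductive EqUpTo : ℕ → Term → Term → Prop
  | zero (M N : Term) : EqUpTo 0 M N
  | var (n k : ℕ) : EqUpTo (n + 1) (var k) (var k)
  | lam {n : ℕ} {M M' : Term} : EqUpTo n M M' → EqUpTo (n + 1) (lam M) (lam M')
  | app {n : ℕ} {M M' N N' : Term} :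
      EqUpTo n M M' → EqUpTo n N N' → EqUpTo (n + 1) (app M N) (app M' N')
  | tau {n : ℕ} {M M' : Term} : EqUpTo n M M' → EqUpTo (n + 1) (tau M) (tau M')

/-- The terms `t γ`, for `γ < l`, converge to `N` as `γ` tends to `l`. -/
def ConvergesTo (t : Ordinal.{0} → Term) (l : Ordinal.{0}) (N : Term) : Prop :=
  ∀ n : ℕ, ∃ β < l, ∀ γ, β ≤ γ → γ < l → EqUpTo n (t γ) N

/-- The depths `d γ`, for `γ < l`, tend to infinity as `γ` tends to `l`. -/
def DepthTendsToInfinity (d : Ordinal.{0} → ℕ) (l : Ordinal.{0}) : Prop :=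
  ∀ n : ℕ, ∃ β < l, ∀ γ, β ≤ γ → γ < l → n ≤ d γ

/-- `(t, d)` is a transfinite rewrite sequence consisting of `α` steps: the step number `β < α` leads
from `t β` to `t (β + 1)` and takes place at depth `d β`, and at each limit ordinal `l < α` the term
`t l` is the limit of the terms before it. Values of `t` and `d` that are not mentioned here are
irrelevant; in particular, if `α` is a limit ordinal, then nothing is said about `t α`. -/
def IsRewriteSeq (α : Ordinal.{0}) (t : Ordinal.{0} → Term) (d : Ordinal.{0} → ℕ) : Prop :=
  (∀ β < α, StepAt (d β) (t β) (t (β + 1))) ∧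
    ∀ l < α, Order.IsSuccLimit l → ConvergesTo t l (t l)

/-- Strong convergence of a rewrite sequence of length `α`: at each limit ordinal `l ≤ α` the depths of
the contracted redexes tend to infinity, and if `α` itself is a limit ordinal, the terms of the sequence
converge to some term. -/
def StronglyConvergent (α : Ordinal.{0}) (t : Ordinal.{0} → Term) (d : Ordinal.{0} → ℕ) : Prop :=
  (∀ l ≤ α, Order.IsSuccLimit l → DepthTendsToInfinity d l) ∧
    (Order.IsSuccLimit α → ∃ N, ConvergesTo t α N)

/-- Infinitary reduction: there is a strongly convergent rewrite sequence, of some ordinal length,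
from `M` to `N`. -/
def InfRed (M N : Term) : Prop :=
  ∃ (α : Ordinal.{0}) (t : Ordinal.{0} → Term) (d : Ordinal.{0} → ℕ),
    IsRewriteSeq α t d ∧ StronglyConvergent α t d ∧
      t 0 = M ∧ t α = N ∧ (Order.IsSuccLimit α → ConvergesTo t α N)

/-- Infinitary strong normalisation: all rewrite sequences are strongly convergent. (For finite
sequences there is nothing to show.) -/
def InfStronglyNormalising : Prop :=
  ∀ (α : Ordinal.{0}) (t : Ordinal.{0} → Term) (d : Ordinal.{0} → ℕ),
    IsRewriteSeq α t d → StronglyConvergent α t d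

/-- Infinitary confluence. -/
def InfConfluent : Prop :=
  ∀ M N₁ N₂ : Term, InfRed M N₁ → InfRed M N₂ → ∃ P, InfRed N₁ P ∧ InfRed N₂ P

/-- Infinitary unique normal forms. -/
def InfUniqueNormalForms : Prop :=
  ∀ M N₁ N₂ : Term, InfRed M N₁ → InfRed M N₂ → NormalForm N₁ → NormalForm N₂ → N₁ = N₂

end ClockedLambda

/-!
Every redex has an application at its root and its contractum has a `τ` there, and a `τ` at the root of a
term is never removed. Hence at most one step of a rewrite sequence takes place at the root. Before and
after that step the sequence splits into sequences of immediate subterms, so by induction only finitely many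
steps take place at each depth (`IdleSeq.finite_depth_lt`), however long the sequence is. This gives strong
convergence, limits existing because the space of terms is complete (`eqUpTo_seqLim`). It also bounds the
length of a rewrite sequence by a countable ordinal, so contracting redexes for as long as possible leads
from every term to a normal form (`exists_infRed_normalForm`).

Confluence and uniqueness of normal forms then follow from an invariant of reduction that fixes the normal
forms. This is the infinitary normal form `nf`, defined corecursively: a term whose left spine is finite and
ends in an abstraction or a `τ` head reduces to some `τ(R)`, and all others are stable at the root; this
exposes the root of `nf M`, and the computation continues in the subterms. To see that `nf` is invariant
under transfinite reduction (`ParSeq.nf_eq`), single steps are generalised to coinductive parallel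
reduction `Par`, which is closed under substitution and therefore commutes with head reduction. The head
normal forms of the terms of a transfinite sequence of parallel reductions form such a sequence again; in it
all roots are equal, and the sequences of subterms are of the same kind, which yields agreement of the
normal forms at all depths by induction. The delicate point is continuity at limit ordinals: head
normalisation is not continuous at terms with an infinite left spine, but reduction never lengthens the
spine above a head redex, so in such a sequence no such term is the limit of terms that head reduce
(`ParSeq.headStable_of_le`).
-/

namespace ClockedLambda

open Term

namespace Term

/-! ### Term trees -/

/-- Case distinction on the root of a term. -/
@[elab_as_elim]
theorem shape {C : Term → Prop} (M : Term) (var : ∀ k, C (var k)) (lam : ∀ P, C (lam P))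
    (app : ∀ P Q, C (app P Q)) (tau : ∀ P, C (tau P)) : C M := by
  rw [← PFunctor.M.mk_dest M]
  rcases PFunctor.M.dest M with ⟨_ | _ | _ | _, k⟩
  · rename_i n
    convert var n using 1
    exact congrArg PFunctor.M.mk (congrArg (Sigma.mk (Label.var n)) (funext (·.elim)))
  · exact lam (k ())
  · convert app (k false) (k true) using 1
    refine congrArg PFunctor.M.mk (congrArg (Sigma.mk Label.app) (funext fun i => ?_))
    cases i <;> rfl
  · exact tau (k ())

/-- The label at the root of a term. -/
def root (M : Term) : Label := (PFunctor.M.dest M).1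

/-- The immediate subterms of a term, indexed by `Bool` regardless of the arity of the root: for an
application `child false` is the function and `child true` the argument, a unary node has both children
equal to its subterm, and a variable is its own child. This makes arguments that descend into a term
uniform in the root. -/
def child (i : Bool) (M : Term) : Term :=
  match PFunctor.M.dest M with
  | ⟨.var _, _⟩ => M
  | ⟨.lam, k⟩ => k ()
  | ⟨.app, k⟩ => k i
  | ⟨.tau, k⟩ => k ()

@[simp] theorem root_var (k : ℕ) : root (var k) = .var k := rfl
@[simp] theorem root_lam (M : Term) : root (lam M) = .lam := rfl
@[simp] theorem root_app (M N : Term) : root (app M N) = .app := rfl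
@[simp] theorem root_tau (M : Term) : root (tau M) = .tau := rfl
@[simp] theorem child_var (i : Bool) (k : ℕ) : child i (var k) = var k := rfl
@[simp] theorem child_lam (i : Bool) (M : Term) : child i (lam M) = M := rfl
@[simp] theorem child_false_app (M N : Term) : child false (app M N) = M := rfl
@[simp] theorem child_true_app (M N : Term) : child true (app M N) = N := rfl
@[simp] theorem child_tau (i : Bool) (M : Term) : child i (tau M) = M := rfl

@[simp] theorem lam_inj {M N : Term} : lam M = lam N ↔ M = N :=
  ⟨fun h => by simpa using congrArg (child false) h, fun h => h ▸ rfl⟩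

@[simp] theorem tau_inj {M N : Term} : tau M = tau N ↔ M = N :=
  ⟨fun h => by simpa using congrArg (child false) h, fun h => h ▸ rfl⟩

@[simp] theorem app_inj {M N M' N' : Term} : app M N = app M' N' ↔ M = M' ∧ N = N' :=
  ⟨fun h => ⟨by simpa using congrArg (child false) h, by simpa using congrArg (child true) h⟩,
    fun h => by rw [h.1, h.2]⟩

theorem ne_of_root_ne {M N : Term} (h : root M ≠ root N) : M ≠ N := fun e => h (e ▸ rfl)

@[simp] theorem lam_ne_app {M P Q : Term} : lam M ≠ app P Q := ne_of_root_ne (by simp)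
@[simp] theorem lam_ne_tau {M P : Term} : lam M ≠ tau P := ne_of_root_ne (by simp)
@[simp] theorem lam_ne_var {M : Term} {k : ℕ} : lam M ≠ var k := ne_of_root_ne (by simp)
@[simp] theorem tau_ne_app {M P Q : Term} : tau M ≠ app P Q := ne_of_root_ne (by simp)
@[simp] theorem tau_ne_lam {M P : Term} : tau M ≠ lam P := ne_of_root_ne (by simp)
@[simp] theorem tau_ne_var {M : Term} {k : ℕ} : tau M ≠ var k := ne_of_root_ne (by simp)
@[simp] theorem app_ne_lam {M P Q : Term} : app P Q ≠ lam M := ne_of_root_ne (by simp)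
@[simp] theorem app_ne_tau {M P Q : Term} : app P Q ≠ tau M := ne_of_root_ne (by simp)
@[simp] theorem app_ne_var {P Q : Term} {k : ℕ} : app P Q ≠ var k := ne_of_root_ne (by simp)
@[simp] theorem var_ne_app {P Q : Term} {k : ℕ} : var k ≠ app P Q := ne_of_root_ne (by simp)

end Term

/-! ### Agreement up to a depth -/

namespace EqUpTo

theorem refl (n : ℕ) (M : Term) : EqUpTo n M M := by
  induction n generalizing M with
  | zero => exact .zero _ _
  | succ n ih =>
    cases M using Term.shape with
    | var k => exact .var _ _
    | lam P => exact .lam (ih _)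
    | app P Q => exact .app (ih _) (ih _)
    | tau P => exact .tau (ih _)

theorem succ_iff {n : ℕ} {M N : Term} :
    EqUpTo (n + 1) M N ↔ root M = root N ∧ ∀ i, EqUpTo n (child i M) (child i N) := by
  constructor
  · intro h
    cases h with
    | var => simp [refl]
    | lam h => simpa using h
    | app h₁ h₂ => simp [h₁, h₂]
    | tau h => simpa using h
  · rintro ⟨h, hc⟩
    cases M using Term.shape <;> cases N using Term.shape <;> simp at h hc
    · subst h
      exact .var _ _
    · exact .lam hc
    · exact .app hc.1 hc.2
    · exact .tau hc

theorem symm {n : ℕ} {M N : Term} (h : EqUpTo n M N) : EqUpTo n N M := by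
  induction n generalizing M N with
  | zero => exact .zero _ _
  | succ n ih =>
    rw [succ_iff] at h ⊢
    exact ⟨h.1.symm, fun i => ih (h.2 i)⟩

theorem trans {n : ℕ} {M N P : Term} (h : EqUpTo n M N) (h' : EqUpTo n N P) : EqUpTo n M P := by
  induction n generalizing M N P with
  | zero => exact .zero _ _
  | succ n ih =>
    rw [succ_iff] at h h' ⊢
    exact ⟨h.1.trans h'.1, fun i => ih (h.2 i) (h'.2 i)⟩

theorem mono {m n : ℕ} (hmn : m ≤ n) {M N : Term} (h : EqUpTo n M N) : EqUpTo m M N := by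
  induction m generalizing n M N with
  | zero => exact .zero _ _
  | succ m ih =>
    obtain ⟨n, rfl⟩ : ∃ k, n = k + 1 := ⟨n - 1, by omega⟩
    rw [succ_iff] at h ⊢
    exact ⟨h.1, fun i => ih (by omega) (h.2 i)⟩

theorem eq {M N : Term} (h : ∀ n, EqUpTo n M N) : M = N := by
  refine PFunctor.M.bisim (fun M N => ∀ n, EqUpTo n M N) ?_ _ _ h
  intro M N h
  have hr := (succ_iff.1 (h 1)).1
  have hc := fun n => (succ_iff.1 (h (n + 1))).2
  clear h
  cases M using Term.shape <;> cases N using Term.shape <;> simp at hr hc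
  · subst hr
    exact ⟨_, _, _, rfl, rfl, fun i => i.elim⟩
  · exact ⟨_, _, _, rfl, rfl, fun _ => hc⟩
  · exact ⟨_, _, _, rfl, rfl, fun i => by cases i; exacts [fun n => (hc n).1, fun n => (hc n).2]⟩
  · exact ⟨_, _, _, rfl, rfl, fun _ => hc⟩

theorem rename {n : ℕ} {M N : Term} (h : EqUpTo n M N) (r : ℕ → ℕ) :
    EqUpTo n (Term.rename r M) (Term.rename r N) := by
  induction h generalizing r with
  | zero => exact .zero _ _
  | var => exact refl _ _
  | lam _ ih => simpa only [rename_lam] using .lam (ih _)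
  | app _ _ ih₁ ih₂ => simpa only [rename_app] using .app (ih₁ _) (ih₂ _)
  | tau _ ih => simpa only [rename_tau] using .tau (ih _)

theorem upSub {n : ℕ} {σ σ' : ℕ → Term} (h : ∀ k, EqUpTo n (σ k) (σ' k)) :
    ∀ k, EqUpTo n (Term.upSub σ k) (Term.upSub σ' k)
  | 0 => refl _ _
  | k + 1 => (h k).rename _

theorem subst {n : ℕ} {M N : Term} (h : EqUpTo n M N) {σ σ' : ℕ → Term}
    (hσ : ∀ k, EqUpTo n (σ k) (σ' k)) : EqUpTo n (Term.subst σ M) (Term.subst σ' N) := by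
  induction h generalizing σ σ' with
  | zero => exact .zero _ _
  | var n k => simpa only [subst_var] using hσ k
  | @lam n M N _ ih =>
    simpa only [subst_lam] using .lam (ih (upSub fun k => (hσ k).mono n.le_succ))
  | @app n _ _ _ _ _ _ ih₁ ih₂ =>
    simpa only [subst_app] using
      .app (ih₁ fun k => (hσ k).mono n.le_succ) (ih₂ fun k => (hσ k).mono n.le_succ)
  | @tau n _ _ _ ih => simpa only [subst_tau] using .tau (ih fun k => (hσ k).mono n.le_succ)

theorem inst {n : ℕ} {M M' N N' : Term} (h : EqUpTo n M M') (h' : EqUpTo n N N') :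
    EqUpTo n (Term.inst M N) (Term.inst M' N') :=
  h.subst fun k => by cases k; exacts [h', refl _ _]

end EqUpTo

/-! ### Completeness of the space of terms -/

/-- One layer of the limit of a Cauchy sequence `s` of terms: `s 1` provides the label. The shift in the
sequences of subterms restores the modulus of convergence, since agreement up to depth `n + 1` of the
terms gives agreement up to depth `n` of their subterms. -/
def limStep (s : ℕ → Term) : Sig (ℕ → Term) :=
  match root (s 1) with
  | .var k => ⟨Label.var k, Empty.elim⟩
  | .lam => ⟨Label.lam, fun _ n => child false (s (n + 1))⟩
  | .app => ⟨Label.app, fun i n => child i (s (n + 1))⟩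
  | .tau => ⟨Label.tau, fun _ n => child false (s (n + 1))⟩

/-- The limit of a sequence of terms whose members from index `n` on agree up to depth `n`. -/
def seqLim (s : ℕ → Term) : Term := PFunctor.M.corec limStep s

theorem eqUpTo_seqLim {s : ℕ → Term} (hs : ∀ m n, m ≤ n → EqUpTo m (s m) (s n)) (n : ℕ) :
    EqUpTo n (s n) (seqLim s) := by
  induction n generalizing s with
  | zero => exact .zero _ _
  | succ n ih =>
    have h1 : root (s 1) = root (s (n + 1)) := (EqUpTo.succ_iff.1 (hs 1 (n + 1) (by omega))).1
    have hc : ∀ i, EqUpTo n (child i (s (n + 1))) (seqLim fun n => child i (s (n + 1))) := fun i =>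
      ih (s := fun n => child i (s (n + 1))) fun a b hab =>
        (EqUpTo.succ_iff.1 (hs (a + 1) (b + 1) (by omega))).2 i
    have hd : PFunctor.M.dest (seqLim s) = Sig.map seqLim (limStep s) := PFunctor.M.dest_corec _ _
    unfold limStep at hd
    generalize seqLim s = L at hd
    generalize s (n + 1) = M at *
    rw [h1] at hd
    cases M using Term.shape with
    | var k =>
      have : L = var k := eq_of_dest_eq (hd.trans (Sigma.ext rfl (heq_of_eq (funext (·.elim)))))
      rw [this]
      exact .var _ _
    | lam P =>
      have : L = lam (seqLim fun n => child false (s (n + 1))) := eq_of_dest_eq hd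
      exact this ▸ .lam (hc false)
    | app P Q =>
      have : L = app (seqLim fun n => child false (s (n + 1)))
          (seqLim fun n => child true (s (n + 1))) :=
        eq_of_dest_eq (hd.trans (Sigma.ext rfl (heq_of_eq (funext fun i => by cases i <;> rfl))))
      exact this ▸ .app (hc false) (hc true)
    | tau P =>
      have : L = tau (seqLim fun n => child false (s (n + 1))) := eq_of_dest_eq hd
      exact this ▸ .tau (hc false)

/-! ### Algebra of renaming and substitution -/

namespace Term

theorem upRen_comp (r s : ℕ → ℕ) : upRen (r ∘ s) = upRen r ∘ upRen s := by
  funext k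
  cases k <;> rfl

theorem rename_rename (r s : ℕ → ℕ) (M : Term) : rename r (rename s M) = rename (r ∘ s) M := by
  refine EqUpTo.eq fun n => ?_
  induction n generalizing r s M with
  | zero => exact .zero _ _
  | succ n ih =>
    cases M using Term.shape with
    | var k => simpa only [rename_var] using .refl _ _
    | lam P => simpa only [rename_lam, upRen_comp] using .lam (ih _ _ _)
    | app P Q => simpa only [rename_app] using .app (ih _ _ _) (ih _ _ _)
    | tau P => simpa only [rename_tau] using .tau (ih _ _ _)

theorem upSub_comp_upRen (σ : ℕ → Term) (r : ℕ → ℕ) : upSub (σ ∘ r) = upSub σ ∘ upRen r := by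
  funext k
  cases k <;> rfl

theorem subst_rename (σ : ℕ → Term) (r : ℕ → ℕ) (M : Term) :
    subst σ (rename r M) = subst (σ ∘ r) M := by
  refine EqUpTo.eq fun n => ?_
  induction n generalizing σ r M with
  | zero => exact .zero _ _
  | succ n ih =>
    cases M using Term.shape with
    | var k => simpa only [rename_var, subst_var] using .refl _ _
    | lam P => simpa only [rename_lam, subst_lam, upSub_comp_upRen] using .lam (ih _ _ _)
    | app P Q => simpa only [rename_app, subst_app] using .app (ih _ _ _) (ih _ _ _)
    | tau P => simpa only [rename_tau, subst_tau] using .tau (ih _ _ _)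

theorem upSub_rename_comp (r : ℕ → ℕ) (σ : ℕ → Term) :
    upSub (rename r ∘ σ) = rename (upRen r) ∘ upSub σ := by
  funext k
  cases k with
  | zero => simp only [upSub, Function.comp_apply, rename_var, upRen]
  | succ k =>
    simp only [upSub, Function.comp_apply, rename_rename]
    rfl

theorem rename_subst (r : ℕ → ℕ) (σ : ℕ → Term) (M : Term) :
    rename r (subst σ M) = subst (rename r ∘ σ) M := by
  refine EqUpTo.eq fun n => ?_
  induction n generalizing σ r M with
  | zero => exact .zero _ _
  | succ n ih =>
    cases M using Term.shape with
    | var k => simpa only [subst_var] using .refl _ _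
    | lam P => simpa only [rename_lam, subst_lam, upSub_rename_comp] using .lam (ih _ _ _)
    | app P Q => simpa only [rename_app, subst_app] using .app (ih _ _ _) (ih _ _ _)
    | tau P => simpa only [rename_tau, subst_tau] using .tau (ih _ _ _)

theorem upSub_subst_comp (ρ σ : ℕ → Term) :
    upSub (subst ρ ∘ σ) = subst (upSub ρ) ∘ upSub σ := by
  funext k
  cases k with
  | zero => simp only [upSub, Function.comp_apply, subst_var]
  | succ k =>
    simp only [upSub, Function.comp_apply, subst_rename, rename_subst]
    rfl

theorem subst_subst (ρ σ : ℕ → Term) (M : Term) :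
    subst ρ (subst σ M) = subst (subst ρ ∘ σ) M := by
  refine EqUpTo.eq fun n => ?_
  induction n generalizing ρ σ M with
  | zero => exact .zero _ _
  | succ n ih =>
    cases M using Term.shape with
    | var k => simpa only [subst_var] using .refl _ _
    | lam P => simpa only [subst_lam, upSub_subst_comp] using .lam (ih _ _ _)
    | app P Q => simpa only [subst_app] using .app (ih _ _ _) (ih _ _ _)
    | tau P => simpa only [subst_tau] using .tau (ih _ _ _)

theorem upSub_var : upSub var = var := by
  funext k
  cases k with
  | zero => rfl
  | succ k => exact rename_var _ _

theorem subst_id (M : Term) : subst var M = M := by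
  refine EqUpTo.eq fun n => ?_
  induction n generalizing M with
  | zero => exact .zero _ _
  | succ n ih =>
    cases M using Term.shape with
    | var k => simpa only [subst_var] using .refl _ _
    | lam P => simpa only [subst_lam, upSub_var] using .lam (ih _)
    | app P Q => simpa only [subst_app] using .app (ih _) (ih _)
    | tau P => simpa only [subst_tau] using .tau (ih _)

theorem rename_inst (r : ℕ → ℕ) (M N : Term) :
    rename r (inst M N) = inst (rename (upRen r) M) (rename r N) := by
  simp only [inst, rename_subst, subst_rename]
  congr 1
  funext k
  cases k with
  | zero => rfl
  | succ k => exact rename_var _ _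

theorem subst_inst (σ : ℕ → Term) (M N : Term) :
    subst σ (inst M N) = inst (subst (upSub σ) M) (subst σ N) := by
  simp only [inst, subst_subst]
  congr 1
  funext k
  cases k with
  | zero =>
    simp only [Function.comp_apply, upSub, subst_var]
    rfl
  | succ k =>
    simp only [Function.comp_apply, upSub, subst_rename, subst_var]
    exact (subst_id _).symm

end Term

/-! ### Parallel reduction -/

/-- One layer of parallel reduction, relating immediate subterms by `R`. -/
inductive ParLayer (R : Term → Term → Prop) : Term → Term → Prop
  | var (k : ℕ) : ParLayer R (var k) (var k)
  | lam {M M' : Term} : R M M' → ParLayer R (lam M) (lam M')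
  | app {M M' N N' : Term} : R M M' → R N N' → ParLayer R (app M N) (app M' N')
  | tau {M M' : Term} : R M M' → ParLayer R (tau M) (tau M')
  | beta {M M' N N' : Term} :
      R M M' → R N N' → ParLayer R (app (lam M) N) (tau (inst M' N'))
  | push {M M' N N' : Term} : R M M' → R N N' → ParLayer R (app (tau M) N) (tau (app M' N'))

theorem ParLayer.mono {R S : Term → Term → Prop} (h : ∀ M N, R M N → S M N) {M N : Term}
    (hMN : ParLayer R M N) : ParLayer S M N := by
  cases hMN with
  | var k => exact .var k
  | lam h₁ => exact .lam (h _ _ h₁)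
  | app h₁ h₂ => exact .app (h _ _ h₁) (h _ _ h₂)
  | tau h₁ => exact .tau (h _ _ h₁)
  | beta h₁ h₂ => exact .beta (h _ _ h₁) (h _ _ h₂)
  | push h₁ h₂ => exact .push (h _ _ h₁) (h _ _ h₂)

/-- Parallel reduction: the contraction, all at once, of an arbitrary and possibly infinite set of redexes
of a term. It is the greatest fixed point of `ParLayer`; being coinductive, it is closed under substitution
of parallel reducts for a variable with infinitely many occurrences. -/
def Par (M N : Term) : Prop :=
  ∃ R : Term → Term → Prop, (∀ A B, R A B → ParLayer R A B) ∧ R M N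

namespace Par

theorem out {M N : Term} (h : Par M N) : ParLayer Par M N := by
  obtain ⟨R, hR, h⟩ := h
  exact (hR _ _ h).mono fun _ _ h => ⟨R, hR, h⟩

theorem mk {M N : Term} (h : ParLayer Par M N) : Par M N :=
  ⟨ParLayer Par, fun _ _ h => h.mono fun _ _ h => h.out, h⟩

/-- Coinduction for `Par`, up to `Par` itself. -/
theorem coinduct (R : Term → Term → Prop)
    (hR : ∀ A B, R A B → ParLayer (fun A B => R A B ∨ Par A B) A B) {M N : Term} (h : R M N) :
    Par M N := by
  refine ⟨fun A B => R A B ∨ Par A B, ?_, .inl h⟩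
  rintro A B (h | h)
  · exact hR _ _ h
  · exact h.out.mono fun _ _ => .inr

theorem refl (M : Term) : Par M M := by
  refine ⟨Eq, ?_, rfl⟩
  rintro A _ rfl
  cases A using Term.shape with
  | var k => exact .var _
  | lam P => exact .lam rfl
  | app P Q => exact .app rfl rfl
  | tau P => exact .tau rfl

theorem of_stepAt {d : ℕ} {M N : Term} (h : StepAt d M N) : Par M N := by
  induction h with
  | beta => exact mk (.beta (refl _) (refl _))
  | push => exact mk (.push (refl _) (refl _))
  | lam _ ih => exact mk (.lam ih)
  | appL _ _ ih => exact mk (.app ih (refl _))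
  | appR _ _ ih => exact mk (.app (refl _) ih)
  | tau _ ih => exact mk (.tau ih)

theorem rename {M N : Term} (h : Par M N) (r : ℕ → ℕ) :
    Par (Term.rename r M) (Term.rename r N) := by
  refine coinduct (fun A B => ∃ r M N, Par M N ∧ A = Term.rename r M ∧ B = Term.rename r N) ?_
    ⟨r, M, N, h, rfl, rfl⟩
  rintro _ _ ⟨r, M, N, h, rfl, rfl⟩
  cases h.out with
  | var k => simpa only [rename_var] using .var _
  | lam h₁ =>
    rw [rename_lam, rename_lam]
    exact .lam (.inl ⟨upRen r, _, _, h₁, rfl, rfl⟩)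
  | app h₁ h₂ =>
    simp only [rename_app]
    exact .app (.inl ⟨_, _, _, h₁, rfl, rfl⟩) (.inl ⟨_, _, _, h₂, rfl, rfl⟩)
  | tau h₁ =>
    simp only [rename_tau]
    exact .tau (.inl ⟨r, _, _, h₁, rfl, rfl⟩)
  | beta h₁ h₂ =>
    simp only [rename_app, rename_lam, rename_tau, rename_inst]
    exact .beta (.inl ⟨_, _, _, h₁, rfl, rfl⟩) (.inl ⟨_, _, _, h₂, rfl, rfl⟩)
  | push h₁ h₂ =>
    simp only [rename_app, rename_tau]
    exact .push (.inl ⟨_, _, _, h₁, rfl, rfl⟩) (.inl ⟨_, _, _, h₂, rfl, rfl⟩)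

theorem upSub {σ σ' : ℕ → Term} (h : ∀ k, Par (σ k) (σ' k)) :
    ∀ k, Par (Term.upSub σ k) (Term.upSub σ' k)
  | 0 => refl _
  | k + 1 => (h k).rename _

theorem subst {M N : Term} (h : Par M N) {σ σ' : ℕ → Term} (hσ : ∀ k, Par (σ k) (σ' k)) :
    Par (Term.subst σ M) (Term.subst σ' N) := by
  refine coinduct (fun A B => ∃ (σ σ' : ℕ → Term) (M N : Term), (∀ k, Par (σ k) (σ' k)) ∧ Par M N ∧
    A = Term.subst σ M ∧ B = Term.subst σ' N) ?_ ⟨σ, σ', M, N, hσ, h, rfl, rfl⟩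
  rintro _ _ ⟨σ, σ', M, N, hσ, h, rfl, rfl⟩
  cases h.out with
  | var k =>
    simp only [subst_var]
    exact (hσ k).out.mono fun _ _ => .inr
  | lam h₁ =>
    simp only [subst_lam]
    exact .lam (.inl ⟨Term.upSub σ, Term.upSub σ', _, _, upSub hσ, h₁, rfl, rfl⟩)
  | app h₁ h₂ =>
    simp only [subst_app]
    exact .app (.inl ⟨_, _, _, _, hσ, h₁, rfl, rfl⟩) (.inl ⟨_, _, _, _, hσ, h₂, rfl, rfl⟩)
  | tau h₁ =>
    simp only [subst_tau]
    exact .tau (.inl ⟨σ, σ', _, _, hσ, h₁, rfl, rfl⟩)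
  | beta h₁ h₂ =>
    simp only [subst_app, subst_lam, subst_tau, subst_inst]
    exact .beta (.inl ⟨_, _, _, _, upSub hσ, h₁, rfl, rfl⟩) (.inl ⟨_, _, _, _, hσ, h₂, rfl, rfl⟩)
  | push h₁ h₂ =>
    simp only [subst_app, subst_tau]
    exact .push (.inl ⟨_, _, _, _, hσ, h₁, rfl, rfl⟩) (.inl ⟨_, _, _, _, hσ, h₂, rfl, rfl⟩)

theorem inst {M M' N N' : Term} (h : Par M M') (h' : Par N N') :
    Par (Term.inst M N) (Term.inst M' N') :=
  h.subst fun k => by cases k; exacts [h', refl _]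

theorem of_lam {M X : Term} (h : Par (lam M) X) : ∃ M', X = lam M' ∧ Par M M' := by
  generalize e : Term.lam M = L at h
  cases h.out <;> simp at e
  subst e
  exact ⟨_, rfl, ‹_›⟩

theorem of_tau {M X : Term} (h : Par (tau M) X) : ∃ M', X = tau M' ∧ Par M M' := by
  generalize e : Term.tau M = L at h
  cases h.out <;> simp at e
  subst e
  exact ⟨_, rfl, ‹_›⟩

theorem of_app {P Q X : Term} (h : Par (app P Q) X) :
    (∃ P' Q', X = app P' Q' ∧ Par P P' ∧ Par Q Q') ∨
      (∃ M M' Q', P = lam M ∧ X = tau (Term.inst M' Q') ∧ Par M M' ∧ Par Q Q') ∨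
      ∃ M M' Q', P = tau M ∧ X = tau (app M' Q') ∧ Par M M' ∧ Par Q Q' := by
  generalize e : Term.app P Q = L at h
  cases h.out <;> simp at e <;> obtain ⟨rfl, rfl⟩ := e
  · exact .inl ⟨_, _, rfl, ‹_›, ‹_›⟩
  · exact .inr (.inl ⟨_, _, _, rfl, rfl, ‹_›, ‹_›⟩)
  · exact .inr (.inr ⟨_, _, _, rfl, rfl, ‹_›, ‹_›⟩)

theorem to_lam {M' X : Term} (h : Par X (lam M')) : ∃ M, X = lam M := by
  generalize e : Term.lam M' = L at h
  cases h.out <;> simp at e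
  exact ⟨_, rfl⟩

theorem to_app {P' Q' X : Term} (h : Par X (app P' Q')) : ∃ P Q, X = app P Q ∧ Par P P' := by
  generalize e : Term.app P' Q' = L at h
  cases h.out <;> simp at e
  obtain ⟨rfl, rfl⟩ := e
  exact ⟨_, _, rfl, ‹_›⟩

theorem to_tau {M' X : Term} (h : Par X (tau M')) :
    (∃ M, X = tau M) ∨ (∃ M N, X = app (lam M) N) ∨ ∃ M N, X = app (tau M) N := by
  generalize e : Term.tau M' = L at h
  cases h.out <;> simp at e
  · exact .inl ⟨_, rfl⟩
  · exact .inr (.inl ⟨_, _, rfl⟩)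
  · exact .inr (.inr ⟨_, _, rfl⟩)

end Par

/-! ### Head reduction -/

/-- `HeadRed m M R`: the left spine of `M` consists of `m + 1` applications above an abstraction or a `τ`,
and contracting the spine redexes from the bottom upwards leads from `M` to `τ(R)`. -/
inductive HeadRed : ℕ → Term → Term → Prop
  | beta (M N : Term) : HeadRed 0 (app (lam M) N) (inst M N)
  | push (M N : Term) : HeadRed 0 (app (tau M) N) (app M N)
  | app {m : ℕ} {P P' : Term} (Q : Term) : HeadRed m P P' → HeadRed (m + 1) (app P Q) (app P' Q)

namespace HeadRed

theorem exists_app {m : ℕ} {M R : Term} (h : HeadRed m M R) : ∃ P Q, M = Term.app P Q := by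
  cases h <;> exact ⟨_, _, rfl⟩

theorem exists_step {m : ℕ} {M R : Term} (h : HeadRed m M R) : ∃ N, Step M N := by
  induction h with
  | beta M N => exact ⟨_, 0, .beta M N⟩
  | push M N => exact ⟨_, 0, .push M N⟩
  | app Q _ ih =>
    obtain ⟨N, d, h⟩ := ih
    exact ⟨_, _, .appL Q h⟩

theorem unique {m m' : ℕ} {M R R' : Term} (h : HeadRed m M R) (h' : HeadRed m' M R') : R = R' := by
  induction h generalizing m' R' with
  | beta M N =>
    generalize e : Term.app (Term.lam M) N = L at h'
    cases h' with
    | beta | push =>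
      simp at e
      try rw [e.1, e.2]
    | app Q h =>
      obtain ⟨P, Q, rfl⟩ := h.exists_app
      simp at e
  | push M N =>
    generalize e : Term.app (Term.tau M) N = L at h'
    cases h' with
    | beta | push =>
      simp at e
      try rw [e.1, e.2]
    | app Q h =>
      obtain ⟨P, Q, rfl⟩ := h.exists_app
      simp at e
  | @app m P P' Q h ih =>
    obtain ⟨A, B, rfl⟩ := h.exists_app
    generalize e : Term.app (Term.app A B) Q = L at h'
    cases h' with
    | beta | push => simp at e
    | app Q h' =>
      rw [app_inj] at e
      obtain ⟨rfl, rfl⟩ := e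
      rw [ih h']

/-- Parallel reduction commutes with head reduction and never lengthens the spine. -/
theorem par {m : ℕ} {M N R : Term} (h : HeadRed m M R) (hMN : Par M N) :
    ∃ R', Par R R' ∧ (N = tau R' ∨ ∃ m' ≤ m, HeadRed m' N R') := by
  induction h generalizing N with
  | beta M Q =>
    rcases hMN.of_app with ⟨P', Q', rfl, hP, hQ⟩ | ⟨M₁, M', Q', e, rfl, hM, hQ⟩ |
      ⟨M₁, M', Q', e, -⟩
    · obtain ⟨M', rfl, hM⟩ := hP.of_lam
      exact ⟨_, hM.inst hQ, .inr ⟨0, le_rfl, .beta _ _⟩⟩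
    · rw [lam_inj] at e
      subst e
      exact ⟨_, hM.inst hQ, .inl rfl⟩
    · simp at e
  | push M Q =>
    rcases hMN.of_app with ⟨P', Q', rfl, hP, hQ⟩ | ⟨M₁, M', Q', e, -⟩ |
      ⟨M₁, M', Q', e, rfl, hM, hQ⟩
    · obtain ⟨M', rfl, hM⟩ := hP.of_tau
      exact ⟨_, .mk (.app hM hQ), .inr ⟨0, le_rfl, .push _ _⟩⟩
    · simp at e
    · rw [tau_inj] at e
      subst e
      exact ⟨_, .mk (.app hM hQ), .inl rfl⟩
  | @app m P P₁ Q h ih =>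
    obtain ⟨A, B, rfl⟩ := h.exists_app
    rcases hMN.of_app with ⟨P', Q', rfl, hP, hQ⟩ | ⟨M₁, M', Q', e, -⟩ | ⟨M₁, M', Q', e, -⟩
    · obtain ⟨R', hR, rfl | ⟨m', hm, h'⟩⟩ := ih hP
      · exact ⟨_, .mk (.app hR hQ), .inr ⟨0, by omega, .push _ _⟩⟩
      · exact ⟨_, .mk (.app hR hQ), .inr ⟨m' + 1, by omega, .app _ h'⟩⟩
    · simp at e
    · simp at e

/-- Parallel reduction creates no head redex. -/
theorem of_par {m : ℕ} {M N R : Term} (h : HeadRed m N R) (hMN : Par M N) :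
    ∃ m' R', HeadRed m' M R' := by
  induction h generalizing M with
  | beta A B =>
    obtain ⟨P, Q, rfl, hP⟩ := hMN.to_app
    obtain ⟨M, rfl⟩ := hP.to_lam
    exact ⟨_, _, .beta _ _⟩
  | push A B =>
    obtain ⟨P, Q, rfl, hP⟩ := hMN.to_app
    obtain ⟨M, rfl⟩ | ⟨M, N, rfl⟩ | ⟨M, N, rfl⟩ := hP.to_tau
    · exact ⟨_, _, .push _ _⟩
    · exact ⟨_, _, .app _ (.beta _ _)⟩
    · exact ⟨_, _, .app _ (.push _ _)⟩
  | app B _ ih =>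
    obtain ⟨P, Q, rfl, hP⟩ := hMN.to_app
    obtain ⟨m', R', h⟩ := ih hP
    exact ⟨_, _, .app _ h⟩

/-- Head reduction is continuous at terms whose spine is finite. -/
theorem eqUpTo {m : ℕ} {M N R : Term} (h : HeadRed m M R) {n : ℕ} (hMN : EqUpTo (m + 2 + n) M N) :
    ∃ R', HeadRed m N R' ∧ EqUpTo n R R' := by
  induction h generalizing N with
  | beta A B =>
    rw [show 0 + 2 + n = n + 1 + 1 by omega] at hMN
    generalize e : Term.app (Term.lam A) B = L at hMN
    cases hMN <;> simp at e
    rename_i h₁ h₂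
    obtain ⟨rfl, rfl⟩ := e
    generalize e : Term.lam A = L at h₁
    cases h₁ <;> simp at e
    rename_i h₁
    subst e
    exact ⟨_, .beta _ _, h₁.inst (h₂.mono n.le_succ)⟩
  | push A B =>
    rw [show 0 + 2 + n = n + 1 + 1 by omega] at hMN
    generalize e : Term.app (Term.tau A) B = L at hMN
    cases hMN <;> simp at e
    rename_i h₁ h₂
    obtain ⟨rfl, rfl⟩ := e
    generalize e : Term.tau A = L at h₁
    cases h₁ <;> simp at e
    rename_i h₁
    subst e
    exact ⟨_, .push _ _, (EqUpTo.app h₁ (h₂.mono n.le_succ)).mono n.le_succ⟩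
  | @app m P P' Q h ih =>
    rw [show m + 1 + 2 + n = m + 2 + n + 1 by omega] at hMN
    generalize e : Term.app P Q = L at hMN
    cases hMN <;> simp at e
    rename_i h₁ h₂
    obtain ⟨rfl, rfl⟩ := e
    obtain ⟨R', hR, hE⟩ := ih h₁
    exact ⟨_, .app _ hR, (EqUpTo.app hE (h₂.mono (by omega))).mono n.le_succ⟩

end HeadRed

/-- A term is head stable if it does not head reduce to a term of the form `τ(R)`. The left spine of a
stable application is infinite or ends in a variable. -/
def HeadStable (M : Term) : Prop := ∀ m R, ¬ HeadRed m M R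

theorem headStable_tau (M : Term) : HeadStable (tau M) := fun _ _ h => by
  obtain ⟨P, Q, e⟩ := h.exists_app
  simp at e

theorem headStable_of_par {M N : Term} (h : HeadStable M) (hMN : Par M N) : HeadStable N :=
  fun _ _ hN => by
    obtain ⟨m, R, hM⟩ := hN.of_par hMN
    exact h m R hM

/-- At the root of a stable term, parallel reduction contracts nothing. -/
theorem par_child {M N : Term} (h : HeadStable M) (hMN : Par M N) :
    root M = root N ∧ ∀ i, Par (child i M) (child i N) := by
  cases hMN.out with
  | var k => exact ⟨rfl, fun _ => .refl _⟩
  | lam h' => exact ⟨rfl, fun _ => h'⟩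
  | app h₁ h₂ => exact ⟨rfl, fun i => by cases i; exacts [h₁, h₂]⟩
  | tau h' => exact ⟨rfl, fun _ => h'⟩
  | beta => exact (h _ _ (.beta _ _)).elim
  | push => exact (h _ _ (.push _ _)).elim

open Classical in
/-- The head normal form of `M`: the term `τ(R)` if `M` head reduces to it, and `M` itself if `M` is head
stable. -/
noncomputable def headNF (M : Term) : Term :=
  if h : ∃ R m, HeadRed m M R then tau h.choose else M

theorem HeadRed.headNF_eq {m : ℕ} {M R : Term} (h : HeadRed m M R) : headNF M = tau R := by
  have h' : ∃ R m, HeadRed m M R := ⟨R, m, h⟩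
  rw [headNF, dif_pos h', h'.choose_spec.choose_spec.unique h]

theorem HeadStable.headNF_eq {M : Term} (h : HeadStable M) : headNF M = M :=
  dif_neg fun ⟨R, m, h'⟩ => h m R h'

theorem headStable_headNF (M : Term) : HeadStable (headNF M) := by
  by_cases h : HeadStable M
  · rwa [h.headNF_eq]
  · simp only [HeadStable, not_forall, not_not] at h
    obtain ⟨m, R, h⟩ := h
    rw [h.headNF_eq]
    exact headStable_tau R

theorem Par.headNF {M N : Term} (h : Par M N) : Par (headNF M) (headNF N) := by
  by_cases hM : HeadStable M
  · rwa [hM.headNF_eq, (headStable_of_par hM h).headNF_eq]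
  · simp only [HeadStable, not_forall, not_not] at hM
    obtain ⟨m, R, hM⟩ := hM
    obtain ⟨R', hR, rfl | ⟨m', -, hN⟩⟩ := hM.par h
    · rw [hM.headNF_eq, (headStable_tau R').headNF_eq]
      exact .mk (.tau hR)
    · rw [hM.headNF_eq, hN.headNF_eq]
      exact .mk (.tau hR)

/-! ### Infinitary normal forms -/

/-- The infinitary normal form of a term, obtained by head normalising at every depth. -/
noncomputable def nf : Term → Term := PFunctor.M.corec fun M => PFunctor.M.dest (headNF M)

theorem dest_nf (M : Term) : PFunctor.M.dest (nf M) = Sig.map nf (PFunctor.M.dest (headNF M)) :=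
  PFunctor.M.dest_corec _ _

theorem root_nf (M : Term) : root (nf M) = root (headNF M) := by
  rw [root, dest_nf]
  rfl

theorem headNF_var (k : ℕ) : headNF (var k) = var k :=
  HeadStable.headNF_eq fun _ _ h => by
    obtain ⟨P, Q, e⟩ := h.exists_app
    simp at e

theorem child_nf (i : Bool) (M : Term) : child i (nf M) = nf (child i (headNF M)) := by
  have hd := dest_nf M
  have hv : ∀ k, nf (var k) = var k := fun k => by
    refine eq_of_dest_eq ?_
    rw [dest_nf, headNF_var]
    exact Sigma.ext rfl (heq_of_eq (funext (·.elim)))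
  generalize nf M = L at hd
  generalize headNF M = H at hd
  cases H using Term.shape with
  | var k =>
    have : L = var k := eq_of_dest_eq (hd.trans (Sigma.ext rfl (heq_of_eq (funext (·.elim)))))
    rw [this, child_var, hv]
  | lam P =>
    have : L = lam (nf P) := eq_of_dest_eq hd
    rw [this, child_lam, child_lam]
  | app P Q =>
    have : L = app (nf P) (nf Q) :=
      eq_of_dest_eq (hd.trans (Sigma.ext rfl (heq_of_eq (funext fun i => by cases i <;> rfl))))
    rw [this]
    cases i <;> rfl
  | tau P =>
    have : L = tau (nf P) := eq_of_dest_eq hd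
    rw [this, child_tau, child_tau]

theorem NormalForm.child {M : Term} (h : NormalForm M) (i : Bool) : NormalForm (child i M) := by
  rintro N ⟨d, hN⟩
  cases M using Term.shape with
  | var k => exact h _ ⟨_, hN⟩
  | lam P => exact h _ ⟨_, .lam hN⟩
  | app P Q =>
    cases i
    · exact h _ ⟨_, .appL Q hN⟩
    · exact h _ ⟨_, .appR P hN⟩
  | tau P => exact h _ ⟨_, .tau hN⟩

theorem NormalForm.nf_eq {M : Term} (h : NormalForm M) : nf M = M := by
  refine EqUpTo.eq fun n => ?_
  induction n generalizing M with
  | zero => exact .zero _ _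
  | succ n ih =>
    have hM : headNF M = M := HeadStable.headNF_eq fun m R hR => by
      obtain ⟨N, hN⟩ := hR.exists_step
      exact h N hN
    rw [EqUpTo.succ_iff, root_nf, hM]
    exact ⟨rfl, fun i => by rw [child_nf, hM]; exact ih (h.child i)⟩

/-! ### Transfinite sequences of parallel reductions -/

theorem ConvergesTo.comp_child {t : Ordinal.{0} → Term} {l : Ordinal.{0}} {N : Term}
    (h : ConvergesTo t l N) (i : Bool) : ConvergesTo (fun β => child i (t β)) l (child i N) :=
  fun n => by
    obtain ⟨β, hβ, hE⟩ := h (n + 1)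
    exact ⟨β, hβ, fun γ h₁ h₂ => (EqUpTo.succ_iff.1 (hE γ h₁ h₂)).2 i⟩

/-- Transfinite induction over the interval `[a, b)`. -/
theorem interval_induction {a b : Ordinal.{0}} {C : Ordinal.{0} → Prop} (ha : C a)
    (succ : ∀ β, a ≤ β → β + 1 < b → C β → C (β + 1))
    (limit : ∀ l, Order.IsSuccLimit l → a < l → l < b → (∀ β, a ≤ β → β < l → C β) → C l) :
    ∀ γ, a ≤ γ → γ < b → C γ := by
  intro γ
  induction γ using Ordinal.limitRecOn with
  | zero => exact fun h _ => nonpos_iff_eq_zero.1 h ▸ ha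
  | add_one γ ih =>
    intro h hb
    rcases h.eq_or_lt with rfl | h
    · exact ha
    · have h' := Order.lt_add_one_iff.1 h
      exact succ γ h' hb (ih h' ((Order.lt_add_one_iff.2 le_rfl).trans hb))
  | limit l hl ih =>
    intro h hb
    rcases h.eq_or_lt with rfl | h
    · exact ha
    · exact limit l hl h hb fun β h₁ h₂ => ih β h₂ h₁ (h₂.trans hb)

/-- A transfinite sequence of parallel reduction steps from `t 0` to `t α`, continuous at limit ordinals. -/
structure ParSeq (α : Ordinal.{0}) (t : Ordinal.{0} → Term) : Prop where
  par : ∀ β < α, Par (t β) (t (β + 1))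
  limit : ∀ l ≤ α, Order.IsSuccLimit l → ConvergesTo t l (t l)

namespace ParSeq

variable {α : Ordinal.{0}} {t : Ordinal.{0} → Term}

/-- A term that head reduces does not reach a stable term with a root other than `τ`. The length of the spine
above the head redex never increases along the sequence, so a finite spine cannot grow into an infinite one
in the limit. -/
theorem headStable_of_le (h : ParSeq α t) {β γ : Ordinal.{0}} (hβγ : β ≤ γ) (hγ : γ ≤ α)
    (hs : HeadStable (t γ)) (hr : root (t γ) ≠ .tau) : HeadStable (t β) := by
  intro m R hβ
  have key := interval_induction (b := α + 1)
    (C := fun γ => root (t γ) = .tau ∨ ∃ m' ≤ m, ∃ R, HeadRed m' (t γ) R)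
    (.inr ⟨m, le_rfl, R, hβ⟩) ?_ ?_ γ hβγ (Order.lt_add_one_iff.2 hγ)
  · obtain h | ⟨m', -, R, h⟩ := key
    · exact hr h
    · exact hs _ _ h
  · rintro δ - hδ hC
    have hp := h.par δ (lt_of_add_lt_add_right hδ)
    generalize t δ = M at hC hp
    generalize t (δ + 1) = N at hp ⊢
    obtain hM | ⟨m', hm, R, hM⟩ := hC
    · cases M using Term.shape <;> simp at hM
      obtain ⟨N', rfl, -⟩ := hp.of_tau
      exact .inl rfl
    · obtain ⟨R', -, rfl | ⟨m'', hm', hN⟩⟩ := hM.par hp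
      · exact .inl rfl
      · exact .inr ⟨m'', hm'.trans hm, R', hN⟩
  · intro l hl hβl hlα hC
    -- Agreement up to depth `m + 2` covers a spine of at most `m + 1` applications and the node below it.
    obtain ⟨β₁, hβ₁, hE⟩ := h.limit l (Order.lt_add_one_iff.1 hlα) hl (m + 2)
    have hE' := hE _ (le_max_right β β₁) (max_lt hβl hβ₁)
    obtain hM | ⟨m', hm, R, hM⟩ := hC _ (le_max_left β β₁) (max_lt hβl hβ₁)
    · exact .inl ((EqUpTo.succ_iff.1 hE').1.symm.trans hM)
    · obtain ⟨R', hR, -⟩ := hM.eqUpTo (n := 0) (hE'.mono (by omega))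
      exact .inr ⟨m', hm, R', hR⟩

/-- Head normalisation is not continuous at terms with an infinite spine, since a redex may hide at
arbitrary depth of the spine of nearby terms. Along a sequence of reductions this cannot happen. -/
theorem headNF (h : ParSeq α t) : ParSeq α fun β => headNF (t β) where
  par β hβ := (h.par β hβ).headNF
  limit l hl hlim n := by
    by_cases hs : HeadStable (t l)
    · obtain ⟨β, hβ, hE⟩ := h.limit l hl hlim (n + 1)
      refine ⟨β, hβ, fun γ h₁ h₂ => ?_⟩
      have hE' := hE γ h₁ h₂
      have hγ : HeadStable (t γ) := by
        by_cases hr : root (t l) = .tau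
        · have hr' := (EqUpTo.succ_iff.1 hE').1.trans hr
          generalize t γ = M at hr'
          cases M using Term.shape <;> simp at hr'
          exact headStable_tau _
        · exact h.headStable_of_le h₂.le hl hs hr
      simp only [hs.headNF_eq, hγ.headNF_eq]
      exact hE'.mono n.le_succ
    · simp only [HeadStable, not_forall, not_not] at hs
      obtain ⟨m, R, hs⟩ := hs
      obtain ⟨β, hβ, hE⟩ := h.limit l hl hlim (m + 2 + n)
      refine ⟨β, hβ, fun γ h₁ h₂ => ?_⟩
      obtain ⟨R', hR, hE'⟩ := hs.eqUpTo (hE γ h₁ h₂).symm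
      simp only [hs.headNF_eq, hR.headNF_eq]
      exact (EqUpTo.tau hE'.symm).mono n.le_succ

theorem child (h : ParSeq α t) (hs : ∀ β, HeadStable (t β)) (i : Bool) :
    ParSeq α fun β => child i (t β) where
  par β hβ := (par_child (hs β) (h.par β hβ)).2 i
  limit l hl hlim := (h.limit l hl hlim).comp_child i

theorem root_eq (h : ParSeq α t) (hs : ∀ β, HeadStable (t β)) : root (t 0) = root (t α) := by
  refine interval_induction (b := α + 1) (C := fun γ => root (t 0) = root (t γ)) rfl ?_ ?_ α
    bot_le (Order.lt_add_one_iff.2 le_rfl)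
  · exact fun β _ hβ hC =>
      hC.trans (par_child (hs β) (h.par β (lt_of_add_lt_add_right hβ))).1
  · intro l hl hl₀ hlα hC
    obtain ⟨β, hβ, hE⟩ := h.limit l (Order.lt_add_one_iff.1 hlα) hl 1
    exact (hC β bot_le hβ).trans (EqUpTo.succ_iff.1 (hE β le_rfl hβ)).1

/-- The terms of a transfinite sequence of parallel reductions have the same infinitary normal form. -/
theorem nf_eq (h : ParSeq α t) : nf (t 0) = nf (t α) := by
  refine EqUpTo.eq fun n => ?_
  induction n generalizing t with
  | zero => exact .zero _ _
  | succ n ih =>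
    have hs : ∀ β, HeadStable (ClockedLambda.headNF (t β)) := fun β => headStable_headNF _
    rw [EqUpTo.succ_iff, root_nf, root_nf]
    refine ⟨h.headNF.root_eq hs, fun i => ?_⟩
    rw [child_nf, child_nf]
    exact ih (h.headNF.child hs i)

end ParSeq

/-- Infinitary reduction does not change the infinitary normal form. -/
theorem InfRed.nf_eq {M N : Term} (h : InfRed M N) : nf M = nf N := by
  obtain ⟨α, t, d, hseq, -, rfl, rfl, hα⟩ := h
  refine ParSeq.nf_eq ⟨fun β hβ => .of_stepAt (hseq.1 β hβ), fun l hl hlim => ?_⟩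
  rcases hl.eq_or_lt with rfl | hl
  · exact hα hlim
  · exact hseq.2 l hl hlim

/-! ### Strong normalisation -/

theorem StepAt.root_of_zero {M N : Term} (h : StepAt 0 M N) : root M = .app ∧ root N = .tau := by
  cases h <;> exact ⟨rfl, rfl⟩

theorem StepAt.of_succ {d : ℕ} {M N : Term} (h : StepAt (d + 1) M N) :
    root M = root N ∧ (∀ i, StepAt d (child i M) (child i N) ∨ child i M = child i N) ∧
      ∃ i, StepAt d (child i M) (child i N) := by
  cases h with
  | lam h => exact ⟨rfl, fun _ => .inl h, false, h⟩
  | appL _ h => exact ⟨rfl, fun i => by cases i; exacts [.inl h, .inr rfl], false, h⟩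
  | appR _ h => exact ⟨rfl, fun i => by cases i; exacts [.inr rfl, .inl h], true, h⟩
  | tau h => exact ⟨rfl, fun _ => .inl h, false, h⟩

theorem EqUpTo.of_stepAt {d : ℕ} {M N : Term} (h : StepAt d M N) : EqUpTo d M N := by
  induction h with
  | beta | push => exact .zero _ _
  | lam _ ih => exact .lam ih
  | appL _ _ ih => exact .app ih (.refl _ _)
  | appR _ _ ih => exact .app (.refl _ _) ih
  | tau _ ih => exact .tau ih

/-- A rewrite sequence indexed by the interval `[a, b)` in which a step takes place only at the indices
in `S`; at the other indices the term stays the same. Idle indices arise on passing from a sequence to the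
sequence of the terms at a fixed position. -/
structure IdleSeq (a b : Ordinal.{0}) (S : Set Ordinal.{0}) (t : Ordinal.{0} → Term)
    (d : Ordinal.{0} → ℕ) : Prop where
  step : ∀ β, a ≤ β → β < b → β ∈ S → StepAt (d β) (t β) (t (β + 1))
  idle : ∀ β, a ≤ β → β < b → β ∉ S → t β = t (β + 1)
  limit : ∀ l, a < l → l < b → Order.IsSuccLimit l → ConvergesTo t l (t l)

namespace IdleSeq

variable {a b : Ordinal.{0}} {S : Set Ordinal.{0}} {t : Ordinal.{0} → Term} {d : Ordinal.{0} → ℕ}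

theorem mono (h : IdleSeq a b S t d) {a' b' : Ordinal.{0}} (ha : a ≤ a') (hb : b' ≤ b) :
    IdleSeq a' b' S t d where
  step β h₁ h₂ := h.step β (ha.trans h₁) (h₂.trans_le hb)
  idle β h₁ h₂ := h.idle β (ha.trans h₁) (h₂.trans_le hb)
  limit l h₁ h₂ := h.limit l (ha.trans_lt h₁) (h₂.trans_le hb)

/-- A root step produces a `τ` at the root, which stays there for the rest of the sequence. -/
theorem root_eq_tau (h : IdleSeq a b S t d) {β : Ordinal.{0}} (ha : a ≤ β) (hb : β < b)
    (hS : β ∈ S) (hd : d β = 0) : ∀ γ, β < γ → γ < b → root (t γ) = .tau := by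
  intro γ hβγ
  refine interval_induction (a := β + 1) (C := fun γ => root (t γ) = .tau) ?_ ?_ ?_ γ
    (Order.add_one_le_of_lt hβγ)
  · have hs := h.step β ha hb hS
    rw [hd] at hs
    exact hs.root_of_zero.2
  · intro γ hγ hγb hC
    have hγa : a ≤ γ := ha.trans ((Order.lt_add_one_iff.2 le_rfl).le.trans hγ)
    have hγb' : γ < b := (Order.lt_add_one_iff.2 le_rfl).trans hγb
    by_cases hS : γ ∈ S
    · have hs := h.step γ hγa hγb' hS
      cases hd : d γ with
      | zero =>
        rw [hd] at hs
        rw [hs.root_of_zero.1] at hC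
        simp at hC
      | succ n =>
        rw [hd] at hs
        exact hs.of_succ.1 ▸ hC
    · exact h.idle γ hγa hγb' hS ▸ hC
  · intro l hl hβl hlb hC
    have hal : a < l := (ha.trans_lt (Order.lt_add_one_iff.2 le_rfl)).trans hβl
    obtain ⟨β₁, hβ₁, hE⟩ := h.limit l hal hlb hl 1
    have hE' := hE _ (le_max_right (β + 1) β₁) (max_lt hβl hβ₁)
    rw [← (EqUpTo.succ_iff.1 hE').1]
    exact hC _ (le_max_left _ _) (max_lt hβl hβ₁)

/-- Without root steps, a sequence induces sequences of immediate subterms. -/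
theorem child (h : IdleSeq a b S t d) (hd : ∀ β, a ≤ β → β < b → β ∈ S → d β ≠ 0) (i : Bool) :
    IdleSeq a b {β ∈ S | StepAt (d β - 1) (child i (t β)) (child i (t (β + 1)))}
      (fun β => child i (t β)) (fun β => d β - 1) where
  step _ _ _ hS := hS.2
  idle β h₁ h₂ hS := by
    by_cases hS' : β ∈ S
    · obtain ⟨n, hn⟩ := Nat.exists_eq_succ_of_ne_zero (hd β h₁ h₂ hS')
      have hs := h.step β h₁ h₂ hS'
      rw [hn] at hs
      refine (hs.of_succ.2.1 i).resolve_left fun hi => hS ⟨hS', ?_⟩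
      rw [hn]
      exact hi
    · simp only [h.idle β h₁ h₂ hS']
  limit l h₁ h₂ hl := (h.limit l h₁ h₂ hl).comp_child i

/-- Only finitely many steps take place at any given depth: there is at most one root step, and before and
after it all steps take place inside the immediate subterms. -/
theorem finite_depth_lt (h : IdleSeq a b S t d) (n : ℕ) :
    {β | a ≤ β ∧ β < b ∧ β ∈ S ∧ d β < n}.Finite := by
  induction n generalizing a b S t d with
  | zero => simp
  | succ n ih =>
    have key : ∀ {a b : Ordinal.{0}}, IdleSeq a b S t d →
        (∀ β, a ≤ β → β < b → β ∈ S → d β ≠ 0) →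
        {β | a ≤ β ∧ β < b ∧ β ∈ S ∧ d β < n + 1}.Finite := by
      intro a b h hd
      refine ((ih (h.child hd false)).union (ih (h.child hd true))).subset ?_
      rintro β ⟨h₁, h₂, hS, hn⟩
      obtain ⟨m, hm⟩ := Nat.exists_eq_succ_of_ne_zero (hd β h₁ h₂ hS)
      have hs := h.step β h₁ h₂ hS
      rw [hm] at hs
      obtain ⟨i, hi⟩ := hs.of_succ.2.2
      have hi' : StepAt (d β - 1) (ClockedLambda.Term.child i (t β))
          (ClockedLambda.Term.child i (t (β + 1))) := by
        rw [hm]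
        exact hi
      cases i
      · exact .inl ⟨h₁, h₂, ⟨hS, hi'⟩, show d β - 1 < n by omega⟩
      · exact .inr ⟨h₁, h₂, ⟨hS, hi'⟩, show d β - 1 < n by omega⟩
    by_cases hd : ∀ β, a ≤ β → β < b → β ∈ S → d β ≠ 0
    · exact key h hd
    · push Not at hd
      obtain ⟨β₀, ha, hb, hS, hd⟩ := hd
      -- A root step contracts an application, so no root step can follow another one.
      have root_app : ∀ β, a ≤ β → β < b → β ∈ S → d β = 0 → root (t β) = .app := by
        intro β h₁ h₂ hS hd
        have hs := h.step β h₁ h₂ hS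
        rw [hd] at hs
        exact hs.root_of_zero.1
      have no_two : ∀ β γ, a ≤ β → β < γ → γ < b → β ∈ S → γ ∈ S → d β = 0 → d γ ≠ 0 := by
        intro β γ h₁ h₂ h₃ hS hS' hd hd'
        have h₄ := h.root_eq_tau h₁ (h₂.trans h₃) hS hd γ h₂ h₃
        rw [root_app γ (h₁.trans h₂.le) h₃ hS' hd'] at h₄
        simp at h₄
      refine (((key (h.mono le_rfl hb.le) ?_).union (Set.finite_singleton β₀)).union
        (key (h.mono (ha.trans (Order.lt_add_one_iff.2 le_rfl).le) le_rfl (a' := β₀ + 1)) ?_)).subset ?_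
      · exact fun β h₁ h₂ hS' hd' => no_two β β₀ h₁ h₂ hb hS' hS hd' hd
      · exact fun β h₁ h₂ hS' =>
          no_two β₀ β ha ((Order.lt_add_one_iff.2 le_rfl).trans_le h₁) h₂ hS hS' hd
      · rintro β ⟨h₁, h₂, hS, hn⟩
        rcases lt_trichotomy β β₀ with hlt | rfl | hlt
        · exact .inl (.inl ⟨h₁, hlt, hS, hn⟩)
        · exact .inl (.inr rfl)
        · exact .inr ⟨Order.add_one_le_of_lt hlt, h₂, hS, hn⟩

end IdleSeq

namespace IsRewriteSeq

variable {α : Ordinal.{0}} {t : Ordinal.{0} → Term} {d : Ordinal.{0} → ℕ}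

theorem finite_depth_lt (h : IsRewriteSeq α t d) (n : ℕ) : {β | β < α ∧ d β < n}.Finite := by
  have h' : IdleSeq 0 α Set.univ t d :=
    ⟨fun β _ hβ _ => h.1 β hβ, fun β _ _ hβ => (hβ trivial).elim, fun l _ hl => h.2 l hl⟩
  exact (h'.finite_depth_lt n).subset fun β hβ => ⟨bot_le, hβ.1, trivial, hβ.2⟩

theorem depthTendsToInfinity (h : IsRewriteSeq α t d) {l : Ordinal.{0}} (hl : l ≤ α)
    (hlim : Order.IsSuccLimit l) : DepthTendsToInfinity d l := by
  intro n
  refine ⟨(h.finite_depth_lt n).toFinset.sup fun β => if β < l then β + 1 else 0, ?_, ?_⟩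
  · rw [Finset.sup_lt_iff hlim.bot_lt]
    intro β _
    split_ifs with hβ
    · exact hlim.succ_lt hβ
    · exact hlim.bot_lt
  · intro γ h₁ h₂
    by_contra! hn
    have := (Finset.le_sup (f := fun β => if β < l then β + 1 else 0)
      ((h.finite_depth_lt n).mem_toFinset.2 ⟨h₂.trans_le hl, hn⟩)).trans h₁
    simp only [h₂, if_true] at this
    exact (Order.lt_add_one_iff.2 le_rfl).not_ge this

/-- Steps at depth at least `n` do not change a term above depth `n`. -/
theorem eqUpTo (h : IsRewriteSeq α t d) {n : ℕ} {β : Ordinal.{0}}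
    (hd : ∀ γ, β ≤ γ → γ < α → n ≤ d γ) : ∀ γ, β ≤ γ → γ < α → EqUpTo n (t β) (t γ) := by
  refine interval_induction (.refl _ _) ?_ ?_
  · intro γ h₁ h₂ hC
    have h₃ : γ < α := (Order.lt_add_one_iff.2 le_rfl).trans h₂
    exact hC.trans ((EqUpTo.of_stepAt (h.1 γ h₃)).mono (hd γ h₁ h₃))
  · intro l hl h₁ h₂ hC
    obtain ⟨β₁, hβ₁, hE⟩ := h.2 l h₂ hl n
    exact (hC _ (le_max_left β β₁) (max_lt h₁ hβ₁)).trans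
      (hE _ (le_max_right β β₁) (max_lt h₁ hβ₁))

theorem exists_limit (h : IsRewriteSeq α t d) (hα : Order.IsSuccLimit α) :
    ∃ N, ConvergesTo t α N := by
  choose β hβ hd using h.depthTendsToInfinity le_rfl hα
  have hE : ∀ n γ, β n ≤ γ → γ < α → EqUpTo n (t (β n)) (t γ) := fun n => h.eqUpTo (hd n)
  have hs : ∀ m n, m ≤ n → EqUpTo m (t (β m)) (t (β n)) := fun m n hmn =>
    (hE m _ (le_max_left (β m) (β n)) (max_lt (hβ m) (hβ n))).trans
      ((hE n _ (le_max_right (β m) (β n)) (max_lt (hβ m) (hβ n))).mono hmn).symm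
  exact ⟨seqLim fun n => t (β n), fun n =>
    ⟨β n, hβ n, fun γ h₁ h₂ => (hE n γ h₁ h₂).symm.trans (eqUpTo_seqLim hs n)⟩⟩

theorem stronglyConvergent (h : IsRewriteSeq α t d) : StronglyConvergent α t d :=
  ⟨fun _ hl hlim => h.depthTendsToInfinity hl hlim, h.exists_limit⟩

/-- A rewrite sequence has countable length. -/
theorem card_le_aleph0 (h : IsRewriteSeq α t d) : α.card ≤ Cardinal.aleph0 := by
  have hc : (Set.Iio α).Countable := by
    refine (Set.countable_iUnion fun n => (h.finite_depth_lt n).countable).mono fun β hβ => ?_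
    exact Set.mem_iUnion.2 ⟨d β + 1, hβ, Nat.lt_succ_self _⟩
  rwa [← Cardinal.le_aleph0_iff_set_countable, Cardinal.mk_Iio_ordinal,
    Cardinal.lift_le_aleph0] at hc

end IsRewriteSeq

/-! ### Existence of normal forms -/

open Classical in
/-- A reduct of `M` in one step, or `M` itself if it is a normal form. -/
noncomputable def someReduct (M : Term) : Term :=
  if h : ∃ N, Step M N then h.choose else M

open Classical in
/-- The limit at `l` of a family of terms indexed by the ordinals below `l`; the value is irrelevant if
there is no limit. -/
noncomputable def someLimit (l : Ordinal.{0}) (t : ∀ β, β < l → Term) : Term :=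
  if h : ∃ N, ConvergesTo (fun β => if hβ : β < l then t β hβ else var 0) l N then h.choose else var 0

/-- The transfinite sequence obtained from `M` by contracting redexes as long as there are any. -/
noncomputable def iterate (M : Term) (β : Ordinal.{0}) : Term :=
  Ordinal.limitRecOn β M (fun _ => someReduct) (fun l _ => someLimit l)

open Classical in
/-- A depth at which `iterate M β` reduces to the next term of the sequence. -/
noncomputable def iterateDepth (M : Term) (β : Ordinal.{0}) : ℕ :=
  if h : ∃ d, StepAt d (iterate M β) (iterate M (β + 1)) then h.choose else 0

theorem stepAt_iterate {M : Term} {β : Ordinal.{0}} (h : ¬ NormalForm (iterate M β)) :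
    StepAt (iterateDepth M β) (iterate M β) (iterate M (β + 1)) := by
  have h₁ : ∃ N, Step (iterate M β) N := by simpa only [NormalForm, not_forall, not_not] using h
  have h₂ : iterate M (β + 1) = someReduct (iterate M β) := Ordinal.limitRecOn_add_one ..
  have h₃ : ∃ d, StepAt d (iterate M β) (iterate M (β + 1)) := by
    rw [h₂, someReduct, dif_pos h₁]
    exact h₁.choose_spec
  rw [iterateDepth, dif_pos h₃]
  exact h₃.choose_spec

theorem convergesTo_iterate {M : Term} {l : Ordinal.{0}} (hl : Order.IsSuccLimit l)
    (h : IsRewriteSeq l (iterate M) (iterateDepth M)) : ConvergesTo (iterate M) l (iterate M l) := by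
  have aux : ∀ N, ConvergesTo (iterate M) l N ↔
      ConvergesTo (fun β => if _ : β < l then iterate M β else var 0) l N := by
    refine fun N => forall_congr' fun n => exists_congr fun β => and_congr_right fun _ =>
      forall_congr' fun γ => forall_congr' fun _ => forall_congr' fun hγ => ?_
    simp only [dif_pos hγ]
  have h₁ : ∃ N, ConvergesTo (fun β => if _ : β < l then iterate M β else var 0) l N := by
    obtain ⟨N, hN⟩ := h.exists_limit hl
    exact ⟨N, (aux N).1 hN⟩
  have h₂ : iterate M l = someLimit l fun β _ => iterate M β := Ordinal.limitRecOn_limit _ _ _ _ hl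
  rw [aux, h₂, someLimit, dif_pos h₁]
  exact h₁.choose_spec

theorem isRewriteSeq_iterate {M : Term} (α : Ordinal.{0})
    (h : ∀ β < α, ¬ NormalForm (iterate M β)) :
    IsRewriteSeq α (iterate M) (iterateDepth M) := by
  induction α using WellFoundedLT.induction with
  | ind α ih =>
    exact ⟨fun β hβ => stepAt_iterate (h β hβ), fun l hl hlim =>
      convergesTo_iterate hlim (ih l hl fun β hβ => h β (hβ.trans hl))⟩

/-- Contracting redexes in any order reaches a normal form after countably many steps, since rewrite
sequences converge and cannot have uncountable length. -/
theorem exists_infRed_normalForm (M : Term) : ∃ N, InfRed M N ∧ NormalForm N := by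
  have hex : ∃ α, NormalForm (iterate M α) := by
    by_contra! h
    have hc := (isRewriteSeq_iterate (Cardinal.aleph 1).ord fun β _ => h β).card_le_aleph0
    rw [Cardinal.card_ord] at hc
    exact hc.not_gt Cardinal.aleph0_lt_aleph_one
  obtain ⟨α, hα, hmin⟩ := WellFounded.has_min wellFounded_lt {α | NormalForm (iterate M α)} hex
  have hseq := isRewriteSeq_iterate α fun β hβ hN => hmin β hN hβ
  exact ⟨_, ⟨α, _, _, hseq, hseq.stronglyConvergent, Ordinal.limitRecOn_zero .., rfl,
    fun hlim => convergesTo_iterate hlim hseq⟩, hα⟩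

/-! ### Confluence and unique normal forms -/

theorem infUniqueNormalForms : InfUniqueNormalForms := fun M N₁ N₂ h₁ h₂ hN₁ hN₂ => by
  rw [← hN₁.nf_eq, ← hN₂.nf_eq, ← h₁.nf_eq, h₂.nf_eq]

theorem infConfluent : InfConfluent := fun M N₁ N₂ h₁ h₂ => by
  obtain ⟨P₁, hP₁, hn₁⟩ := exists_infRed_normalForm N₁
  obtain ⟨P₂, hP₂, hn₂⟩ := exists_infRed_normalForm N₂
  have : P₂ = P₁ := by
    rw [← hn₁.nf_eq, ← hn₂.nf_eq, ← hP₁.nf_eq, ← hP₂.nf_eq, ← h₁.nf_eq, h₂.nf_eq]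
  exact ⟨P₁, hP₁, this ▸ hP₂⟩

end ClockedLambda

theorem mainTheorem1 :
    ClockedLambda.InfConfluent ∧ ClockedLambda.InfStronglyNormalising ∧
      ClockedLambda.InfUniqueNormalForms :=
  ⟨ClockedLambda.infConfluent, fun _ _ _ h => h.stronglyConvergent,
    ClockedLambda.infUniqueNormalForms⟩
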